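/- Let $V$ be a discrete valuation ring with quotient field $F$, let $K/F$ be a finite Galois extension with group $G$, and let $S$ be the integral closure of $V$ in $K$. Assume that $S$ is unramified over $V$, that is, for every maximal ideal $M$ of $S$ the maximal ideal of $V$ generates the maximal ideal of $S_M$ and the residue field of $S$ at $M$ is separable over that of $V$. Let $f:G\times G\to S\setminus\{0\}$ be a normalized two-cocycle, that is, $f(1,\sigma)=f(\sigma,1)=1$ and $$\sigma(f(\tau,\rho))\,f(\sigma,\tau\rho)=f(\sigma,\tau)\,f(\sigma\tau,\rho)\qquad\text{for all }\sigma,\tau,\rho\in G$$ (the values of $f$ are not required to be units of $S$). Let $A_f=\bigoplus_{\sigma\in G}Sx_\sigma$ be the crossed-product order, that is, the free left $S$-module on symbols $x_\sigma$ with the associative multiplication determined by $x_\sigma s=\sigma(s)x_\sigma$ for $s\in S$ and $x_\sigma x_\tau=f(\sigma,\tau)x_{\sigma\tau}$, with identity $x_1$. Then the ring $A_f$ is hereditary (every left ideal and every right ideal of $A_f$ is projective) if and only if $f(\tau,\tau^{-1})\notin M^2$ for every $\tau\in G$ and every maximal ideal $M$ of $S$. -/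

import Mathlib

/-- A normalized two-cocycle on a group `G` acting by ring automorphisms on a commutative ring `R`,
with values in `R` (the values need not be units). -/
structure NormalizedTwoCocycle (G R : Type*) [Group G] [CommRing R] [MulSemiringAction G R] where
  /-- The underlying function of two variables. -/
  val : G → G → R
  cocycle : ∀ σ τ ρ : G, (σ • val τ ρ) * val σ (τ * ρ) = val σ τ * val (σ * τ) ρ
  one_left : ∀ σ : G, val 1 σ = 1
  one_right : ∀ σ : G, val σ 1 = 1

/-- The crossed product `∑ R x_σ`: the free left `R`-module on symbols `x_σ`, `σ ∈ G`. An element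
is its finitely supported family of coefficients; the product is given below. -/
def CrossedProduct {G R : Type*} [Group G] [CommRing R] [MulSemiringAction G R]
    (_f : NormalizedTwoCocycle G R) : Type _ := G →₀ R

namespace CrossedProduct

noncomputable section

variable {G R : Type*} [Group G] [CommRing R] [MulSemiringAction G R]
  {f : NormalizedTwoCocycle G R}

instance : AddCommGroup (CrossedProduct f) := inferInstanceAs (AddCommGroup (G →₀ R))

/-- The element `s x_σ`, as an additive function of `s`. -/
def single (f : NormalizedTwoCocycle G R) (σ : G) : R →+ CrossedProduct f :=
  Finsupp.singleAddHom (M := R) σ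

/-- The additive map out of the crossed product that is `φ σ s` at `s x_σ`. -/
def lift {N : Type*} [AddCommMonoid N] (φ : G → R →+ N) : CrossedProduct f →+ N :=
  Finsupp.liftAddHom (M := R) φ

theorem lift_single {N : Type*} [AddCommMonoid N] (φ : G → R →+ N) (σ : G) (s : R) :
    lift (f := f) φ (single f σ s) = φ σ s :=
  Finsupp.liftAddHom_apply_single (M := R) φ σ s

/-- The biadditive multiplication with `(s x_σ) (t x_τ) = s σ(t) f(σ, τ) x_{στ}`. -/
def mulHom (f : NormalizedTwoCocycle G R) :
    CrossedProduct f →+ CrossedProduct f →+ CrossedProduct f :=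
  lift fun σ ↦ AddMonoidHom.flip <| lift fun τ ↦ AddMonoidHom.flip <|
    AddMonoidHom.mk' (fun s ↦ AddMonoidHom.mk'
      (fun t ↦ single f (σ * τ) (s * (σ • t) * f.val σ τ))
      (fun a b ↦ by rw [smul_add, mul_add, add_mul, map_add]))
      (fun a b ↦ by ext t : 1; simp [add_mul])

instance : Mul (CrossedProduct f) := ⟨fun a b ↦ mulHom f a b⟩

instance : One (CrossedProduct f) := ⟨single f 1 1⟩

theorem mul_def (a b : CrossedProduct f) : a * b = mulHom f a b := rfl

theorem one_def : (1 : CrossedProduct f) = single f 1 1 := rfl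

theorem single_mul_single (σ τ : G) (s t : R) :
    single f σ s * single f τ t = single f (σ * τ) (s * (σ • t) * f.val σ τ) := by
  rw [mul_def, mulHom, lift_single, AddMonoidHom.flip_apply, lift_single]
  rfl

@[elab_as_elim]
theorem induction {p : CrossedProduct f → Prop} (a : CrossedProduct f)
    (single : ∀ σ s, p (single f σ s)) (add : ∀ a b, p a → p b → p (a + b)) : p a :=
  Finsupp.induction_linear (M := R) a (by have h := single 1 0; rwa [map_zero] at h) add single

instance : Ring (CrossedProduct f) :=
  { (inferInstance : AddCommGroup (CrossedProduct f)),
    (inferInstance : Mul (CrossedProduct f)), (inferInstance : One (CrossedProduct f)) with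
    left_distrib := fun a b c ↦ map_add (mulHom f a) b c
    right_distrib := fun a b c ↦ by
      simp only [mul_def, map_add, AddMonoidHom.add_apply]
    zero_mul := fun a ↦ by simp only [mul_def, map_zero, AddMonoidHom.zero_apply]
    mul_zero := fun a ↦ map_zero (mulHom f a)
    one_mul := fun a ↦ by
      induction a using induction with
      | single σ s => rw [one_def, single_mul_single]; simp [f.one_left]
      | add a b ha hb =>
        rw [mul_def] at *
        rw [map_add, ha, hb]
    mul_one := fun a ↦ by
      induction a using induction with
      | single σ s => rw [one_def, single_mul_single]; simp [f.one_right]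
      | add a b ha hb =>
        rw [mul_def] at *
        rw [map_add, AddMonoidHom.add_apply, ha, hb]
    mul_assoc := fun a b c ↦ by
      induction a using induction with
      | add a a' ha ha' =>
        simp only [mul_def, map_add, AddMonoidHom.add_apply] at *
        rw [ha, ha']
      | single σ s =>
        induction b using induction with
        | add b b' hb hb' =>
          simp only [mul_def, map_add, AddMonoidHom.add_apply] at *
          rw [hb, hb']
        | single τ t =>
          induction c using induction with
          | add c c' hc hc' =>
            simp only [mul_def, map_add] at *
            rw [hc, hc']
          | single ρ u =>
            have h := f.cocycle σ τ ρ
            simp only [single_mul_single, mul_assoc, smul_mul', mul_smul]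
            congr 1
            linear_combination (-(s * (σ • t) * (σ • τ • u))) * h }

end

end CrossedProduct

/-- A ring is hereditary if each of its left ideals and each of its right ideals is projective.
Right ideals of `A` are the submodules of `A` over the opposite ring. -/
def IsHereditaryRing (A : Type*) [Ring A] : Prop :=
  (∀ I : Ideal A, Module.Projective A I) ∧
    ∀ I : Submodule Aᵐᵒᵖ A, Module.Projective Aᵐᵒᵖ I

/-!
Let `ϖ` be a uniformizer of `V`. Since `S` is unramified, `ϖ S` is the intersection of the maximal
ideals of `S`, no `M ^ 2` contains `ϖ`, and the inertia groups are trivial. In particular the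
condition on `f` says that every `f(τ, τ⁻¹)` divides `ϖ`
(`IsDedekindDomain.dvd_iff_forall_notMem_sq`).

*Necessity.* The left ideal `A ϖ + A x_{τ⁻¹}` is projective only if `f(τ, τ⁻¹)` divides `ϖ`: compare
coefficients at `x_1` in a section of `A² → A ϖ + A x_{τ⁻¹}`
(`CrossedProduct.val_mul_inv_dvd_of_projective`).

*Sufficiency.* Let `J` be the radical modulo `ϖ` of the form `(a, b) ↦ (a b)_1`, which consists of
the `a` such that `ϖ` divides all `a_σ f(σ, σ⁻¹)`. It plays the role of the Jacobson radical: a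
power of it lies in `ϖ A`, and `A ⧸ J` is semisimple because the inertia groups are trivial. For a maximal
ideal `M` of `S`, write `ρ ≤ σ` if `f(ρ, ρ⁻¹σ) ∉ M`; this is a preorder on `G`, and the identity
`f(ρ, ρ⁻¹σ) f(σ, σ⁻¹ρ) = ρ(f(ρ⁻¹σ, σ⁻¹ρ))` shows that it is total if no `f(τ, τ⁻¹)` lies in the
square of a maximal ideal. A greatest element `σ` for `M` provides a factorization of an
endomorphism of `J`, invertible at `M`, through the left module `A`; together these show that `J` is
projective (`CrossedProduct.projective_traceRadical`).

It remains to see that the projectivity of `J` implies that of every left ideal `L`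
(`Ideal.projective_of_isSemisimpleRing_quotient`). As `A ⧸ J` is semisimple and a power of `J` lies
in `ϖ A`, the module `L ⧸ ϖ L` has projective dimension at most one. So, for a surjection
`p : P → L` from a free module, the preimage `Q` of `ϖ L` is projective. This makes the extension
`P` of `L` by `N = ker p` equal, up to the action of an endomorphism of `N`, to a multiple of itself
by `ϖ`, and the extension splits by Nakayama's lemma.

Right ideals are left ideals of the opposite ring, which is the crossed product of the cocycle
`(σ, τ) ↦ (στ)(f(τ⁻¹, σ⁻¹))`; this has the same values at the pairs `(τ, τ⁻¹)`.
-/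

/-! ### Modules of projective dimension at most one -/

section ProjectiveKernels

/-- If two surjections `P → X` and `P₀ → X` start at projective modules and one of them has a
projective kernel, then so does the other. -/
theorem projective_ker_of_projective_ker {A X P P₀ : Type*} [Ring A] [AddCommGroup X] [Module A X]
    [AddCommGroup P] [Module A P] [AddCommGroup P₀] [Module A P₀]
    [Module.Projective A P] [Module.Projective A P₀] (g : P →ₗ[A] X) (g₀ : P₀ →ₗ[A] X)
    (hg : Function.Surjective g) (hg₀ : Function.Surjective g₀)
    (h : Module.Projective A (LinearMap.ker g₀)) : Module.Projective A (LinearMap.ker g) := by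
  -- `ker g` is a retract of `P × ker g₀`, because `g` and `g₀` factor through each other.
  obtain ⟨u, hu⟩ := Module.projective_lifting_property g g₀ hg
  obtain ⟨v, hv⟩ := Module.projective_lifting_property g₀ g hg₀
  have hu' : ∀ x, g (u x) = g₀ x := fun x ↦ LinearMap.congr_fun hu x
  have hv' : ∀ x, g₀ (v x) = g x := fun x ↦ LinearMap.congr_fun hv x
  let i : LinearMap.ker g →ₗ[A] P × LinearMap.ker g₀ :=
    (LinearMap.ker g).subtype.prod
      ((v.comp (LinearMap.ker g).subtype).codRestrict (LinearMap.ker g₀) fun x ↦ by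
        simp [hv'])
  let s : P × LinearMap.ker g₀ →ₗ[A] LinearMap.ker g :=
    ((LinearMap.id - u.comp v).comp (LinearMap.fst A P (LinearMap.ker g₀)) +
      (u.comp (LinearMap.ker g₀).subtype).comp
        (LinearMap.snd A P (LinearMap.ker g₀))).codRestrict (LinearMap.ker g) fun x ↦ by
        simp [hu', hv']
  refine Module.Projective.of_split i s (LinearMap.ext fun x ↦ Subtype.ext ?_)
  change (x : P) - u (v x) + u (v x) = x
  rw [sub_add_cancel]

/-- A module `X` such that the kernel of every surjection from a projective module onto `X` is
projective, that is, a module of projective dimension at most one. The projective modules are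
taken in one fixed universe. -/
def HasProjectiveKernels.{w, u, v} (A : Type u) [Ring A] (X : Type v) [AddCommGroup X]
    [Module A X] : Prop :=
  ∀ (P : Type w) [AddCommGroup P] [Module A P] [Module.Projective A P] (g : P →ₗ[A] X),
    Function.Surjective g → Module.Projective A (LinearMap.ker g)

universe w u v

variable {A : Type u} [Ring A]

theorem HasProjectiveKernels.of_extension {X : Type v} [AddCommGroup X] [Module A X]
    (Y : Submodule A X) (hY : HasProjectiveKernels.{w} A Y)
    (hX : HasProjectiveKernels.{w} A (X ⧸ Y)) : HasProjectiveKernels.{w} A X := by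
  intro P _ _ _ g hg
  -- The kernel `Q` of `P → X ⧸ Y` is projective and maps onto `Y` with kernel `ker g`.
  have hQ := hX P (Y.mkQ.comp g) (Y.mkQ_surjective.comp hg)
  have hmem : ∀ x : P, x ∈ LinearMap.ker (Y.mkQ.comp g) ↔ g x ∈ Y := fun x ↦ by simp
  let k : LinearMap.ker (Y.mkQ.comp g) →ₗ[A] Y :=
    (g.comp (LinearMap.ker (Y.mkQ.comp g)).subtype).codRestrict Y fun x ↦ (hmem x).1 x.2
  have hk : Function.Surjective k := fun y ↦ by
    obtain ⟨x, hx⟩ := hg y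
    exact ⟨⟨x, (hmem x).2 (hx ▸ y.2)⟩, Subtype.ext hx⟩
  have hker := hY _ k hk
  let e : LinearMap.ker k ≃ₗ[A] LinearMap.ker g :=
    { toFun := fun x ↦ ⟨x.1.1, congrArg Subtype.val (LinearMap.mem_ker.1 x.2)⟩
      invFun := fun x ↦ ⟨⟨x.1, (hmem x).2 (by rw [LinearMap.mem_ker.1 x.2]; exact Y.zero_mem)⟩,
        LinearMap.mem_ker.2 (Subtype.ext (LinearMap.mem_ker.1 x.2))⟩
      map_add' := fun _ _ ↦ rfl
      map_smul' := fun _ _ ↦ rfl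
      left_inv := fun _ ↦ rfl
      right_inv := fun _ ↦ rfl }
  exact Module.Projective.of_equiv e

/-- A retract `X` of a quotient `P₀ ⧸ N` of projective modules has projective kernels. -/
theorem HasProjectiveKernels.of_retract {X : Type v} [AddCommGroup X] [Module A X]
    {E P₀ : Type*} [AddCommGroup E] [Module A E] [AddCommGroup P₀] [Module A P₀]
    [Module.Projective A P₀] (g₀ : P₀ →ₗ[A] E) (hg₀ : Function.Surjective g₀)
    (h : Module.Projective A (LinearMap.ker g₀)) (i : X →ₗ[A] E) (s : E →ₗ[A] X)
    (hsi : ∀ x, s (i x) = x) : HasProjectiveKernels.{w} A X := by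
  intro P _ _ _ g hg
  -- `P × P₀ → E`, `(p, p₀) ↦ i (g p) + (1 - i s) (g₀ p₀)` is onto; its kernel retracts to `ker g`.
  let q : P × P₀ →ₗ[A] E :=
    (i.comp g).comp (LinearMap.fst A P P₀) +
      ((LinearMap.id - i.comp s).comp g₀).comp (LinearMap.snd A P P₀)
  have hq : Function.Surjective q := fun e ↦ by
    obtain ⟨p, hp⟩ := hg (s e)
    obtain ⟨p₀, hp₀⟩ := hg₀ e
    exact ⟨(p, p₀), by simp [q, hp, hp₀]⟩
  have hker := projective_ker_of_projective_ker q g₀ hq hg₀ h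
  let j : LinearMap.ker g →ₗ[A] LinearMap.ker q :=
    ((LinearMap.inl A P P₀).comp (LinearMap.ker g).subtype).codRestrict _ fun x ↦ by simp [q]
  let t : LinearMap.ker q →ₗ[A] LinearMap.ker g :=
    ((LinearMap.fst A P P₀).comp (LinearMap.ker q).subtype).codRestrict _ fun x ↦ by
      have hx := congrArg s (LinearMap.mem_ker.1 x.2)
      simp only [q, LinearMap.add_apply, LinearMap.comp_apply, LinearMap.sub_apply,
        LinearMap.id_apply, map_add, map_sub, hsi, sub_self, add_zero, map_zero] at hx
      exact hx
  exact Module.Projective.of_split j t (LinearMap.ext fun x ↦ rfl)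

variable (J : Ideal A) [J.IsTwoSided]

/-- If `A ⧸ J` is semisimple and `J` is projective, then every module killed by `J` is a retract of
a sum of copies of `A ⧸ J`, and these have projective dimension at most one. -/
theorem HasProjectiveKernels.of_isTorsionBySet [IsSemisimpleRing (A ⧸ J)] [Module.Projective A J]
    {X : Type v} [AddCommGroup X] [Module A X] (hX : Module.IsTorsionBySet A X J) :
    HasProjectiveKernels.{w} A X := by
  let : Module (A ⧸ J) X := hX.module
  have hsmul : ∀ (a : A) (x : X), (Ideal.Quotient.mk J a) • x = a • x := fun _ _ ↦ rfl
  obtain ⟨s, hs⟩ := Module.projective_def'.1 (Module.projective_of_isSemisimpleRing (A ⧸ J) X)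
  have hs' : ∀ x, Finsupp.linearCombination (A ⧸ J) id (s x) = x := fun x ↦
    LinearMap.congr_fun hs x
  let g₀ : (X →₀ A) →ₗ[A] (X →₀ A ⧸ J) := Finsupp.mapRange.linearMap (Submodule.mkQ J)
  have hg₀ : Function.Surjective g₀ :=
    Finsupp.mapRange_surjective _ (map_zero _) (Submodule.mkQ_surjective J)
  have hsm : ∀ (a : A) (z : X →₀ A ⧸ J), (Ideal.Quotient.mk J a) • z = a • z := fun a z ↦ by
    ext x; rfl
  let e : LinearMap.ker g₀ ≃ₗ[A] (X →₀ J) := (LinearEquiv.ofInjective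
    (Finsupp.mapRange.linearMap (Submodule.subtype J) : (X →₀ J) →ₗ[A] (X →₀ A))
    (Finsupp.mapRange_injective _ (map_zero _) (Submodule.subtype_injective J)) ≪≫ₗ
      LinearEquiv.ofEq _ _ (by
        rw [Finsupp.range_mapRange_linearMap _ (Submodule.ker_subtype J), Finsupp.ker_mapRange,
          Submodule.range_subtype, Submodule.ker_mkQ])).symm
  have hker : Module.Projective A (LinearMap.ker g₀) := by
    classical
    exact Module.Projective.of_equiv (e ≪≫ₗ finsuppLequivDFinsupp A).symm
  refine of_retract g₀ hg₀ hker
    { toFun := s, map_add' := map_add s, map_smul' := fun a x ↦ ?_ }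
    { toFun := Finsupp.linearCombination (A ⧸ J) id, map_add' := map_add _,
      map_smul' := fun a z ↦ ?_ } hs'
  · rw [RingHom.id_apply, ← hsm, ← map_smul, hsmul]
  · rw [RingHom.id_apply, ← hsm, map_smul, hsmul]

theorem HasProjectiveKernels.of_isTorsionBySet_pow [IsSemisimpleRing (A ⧸ J)]
    [Module.Projective A J] (n : ℕ) {X : Type v} [AddCommGroup X] [Module A X]
    (hX : ∀ a ∈ J ^ n, ∀ x : X, a • x = 0) : HasProjectiveKernels.{w} A X := by
  induction n generalizing X with
  | zero =>
    exact of_isTorsionBySet J fun x a ↦ by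
      rw [← one_smul A x, hX 1 (by rw [Submodule.pow_zero, Ideal.one_eq_top]; trivial) x, smul_zero]
  | succ n ih =>
    refine of_extension (J • (⊤ : Submodule A X)) (ih ?_) (of_isTorsionBySet J ?_)
    · rintro a ha ⟨x, hx⟩
      ext
      refine Submodule.smul_induction_on (p := fun x ↦ a • x = 0) hx (fun b hb y _ ↦ ?_)
        (fun x y hx hy ↦ by rw [smul_add, hx, hy, add_zero])
      rw [← mul_smul]
      exact hX _ (by rw [Submodule.pow_succ]; exact Ideal.mul_mem_mul ha hb) y
    · rintro x ⟨a, ha⟩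
      induction x using Submodule.Quotient.induction_on with | _ x =>
      exact (Submodule.Quotient.mk_eq_zero _).2 (Submodule.smul_mem_smul ha trivial)

end ProjectiveKernels

theorem LinearMap.exists_comp_eq_of_forall_mem_range {A M N P : Type*} [Ring A]
    [AddCommGroup M] [Module A M] [AddCommGroup N] [Module A N] [AddCommGroup P] [Module A P]
    (g : M →ₗ[A] P) (m : N →ₗ[A] P) (hm : Function.Injective m)
    (h : ∀ x, g x ∈ LinearMap.range m) : ∃ g' : M →ₗ[A] N, ∀ x, m (g' x) = g x :=
  ⟨(LinearEquiv.ofInjective m hm).symm.toLinearMap.comp (g.codRestrict _ h), fun x ↦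
    congrArg Subtype.val ((LinearEquiv.ofInjective m hm).apply_symm_apply ⟨g x, h x⟩)⟩

/-! ### A criterion for left ideals to be projective -/

section Criterion

universe u

variable {V : Type*} [CommRing V] [IsLocalRing V] [IsNoetherianRing V]

/-- A surjection `p : P → L` onto a module on which `ϖ` is regular splits if its kernel is finite
over `V` and the preimage `Q` of `ϖ L` is projective. Indeed `x ↦ p x / ϖ` on `Q` lifts to
`h : Q → P`, and `x ↦ x - h (ϖ x)` retracts `P` onto `ker p` up to an automorphism, which is
`1 - ϖ h` on `ker p`. -/
theorem Module.Projective.of_projective_comap_range_smul {A : Type*} [Ring A] [Algebra V A]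
    {ϖ : V} (hϖ : ϖ ∈ IsLocalRing.maximalIdeal V)
    {P L : Type*} [AddCommGroup P] [Module A P] [Module V P] [IsScalarTower V A P]
    [AddCommGroup L] [Module A L] [Module V L] [IsScalarTower V A L]
    [Module.Finite V P] [Module.Projective A P]
    (hreg : ∀ x : L, ϖ • x = 0 → x = 0) (p : P →ₗ[A] L) (hp : Function.Surjective p)
    (m : L →ₗ[A] L) (hm : ∀ x, m x = ϖ • x)
    (hQ : Module.Projective A ((LinearMap.range m).comap p)) : Module.Projective A L := by
  have hpV : ∀ (c : V) (x : P), p (c • x) = c • p x := fun c x ↦ by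
    rw [← algebraMap_smul A c x, map_smul, algebraMap_smul]
  have hminj : Function.Injective m := by
    rw [← LinearMap.ker_eq_bot, LinearMap.ker_eq_bot']
    exact fun x hx ↦ hreg x (hm x ▸ hx)
  set Q := (LinearMap.range m).comap p with hQdef
  let l : Q →ₗ[A] L := (LinearEquiv.ofInjective m hminj).symm.toLinearMap.comp
    ((p.comp Q.subtype).codRestrict (LinearMap.range m) fun x ↦ x.2)
  have hl : ∀ x : Q, ϖ • l x = p x := fun x ↦ by
    rw [← hm]
    exact congrArg Subtype.val ((LinearEquiv.ofInjective m hminj).apply_symm_apply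
      ⟨p x, x.2⟩)
  obtain ⟨h, hh⟩ := Module.projective_lifting_property p l hp
  have hh' : ∀ x, p (h x) = l x := fun x ↦ LinearMap.congr_fun hh x
  have hcomm : ∀ (a : A) (x : P), ϖ • a • x = a • ϖ • x := fun a x ↦ by
    rw [← algebraMap_smul A ϖ, ← algebraMap_smul A ϖ, ← mul_smul, ← mul_smul,
      Algebra.commutes]
  let mP : P →ₗ[A] Q :=
    { toFun := fun x ↦ ⟨ϖ • x, ⟨p x, by rw [hm, hpV]⟩⟩
      map_add' := fun x y ↦ Subtype.ext (smul_add _ _ _)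
      map_smul' := fun a x ↦ Subtype.ext (hcomm a x) }
  have hlm : ∀ x, l (mP x) = p x := fun x ↦ by
    refine sub_eq_zero.1 (hreg _ ?_)
    rw [smul_sub, hl, ← hpV, sub_eq_zero]
    rfl
  set N := LinearMap.ker p with hN
  let r : P →ₗ[A] N := (LinearMap.id - h.comp mP).codRestrict N fun x ↦ by
    simp [hN, hh', hlm]
  let θ : N →ₗ[A] N := r.comp N.subtype
  let k : N →ₗ[A] N := (h.comp (Submodule.inclusion (p := N) (p' := Q) fun x hx ↦ by
      rw [hQdef, Submodule.mem_comap, show p x = 0 from hx]; exact zero_mem _)).codRestrict N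
    fun x ↦ by
      refine LinearMap.mem_ker.2 (hreg _ ?_)
      rw [LinearMap.comp_apply, hh', hl]
      exact x.2
  have hθ : ∀ x : N, θ x = x - ϖ • k x := fun x ↦ by
    have hx : mP x = ϖ • Submodule.inclusion (p := N) (p' := Q) (fun x hx ↦ by
      rw [hQdef, Submodule.mem_comap, show p x = 0 from hx]; exact zero_mem _) x := rfl
    ext
    change (x : P) - h (mP x) = x - ϖ • (k x : P)
    rw [hx, ← algebraMap_smul A ϖ, map_smul, algebraMap_smul]
    rfl
  have hθV : ∀ (c : V) (x : N), θ (c • x) = c • θ x := fun c x ↦ by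
    rw [← algebraMap_smul A c x, map_smul, algebraMap_smul]
  let θV : N →ₗ[V] N := { toFun := θ, map_add' := map_add θ, map_smul' := hθV }
  have : IsNoetherian V P := isNoetherian_of_isNoetherianRing_of_finite V P
  have : IsNoetherian V N :=
    isNoetherian_of_injective (N.subtype.restrictScalars V) N.subtype_injective
  have hsurj : Function.Surjective θV := by
    rw [← LinearMap.range_eq_top, eq_top_iff]
    refine Submodule.le_of_le_smul_of_le_jacobson_bot (I := IsLocalRing.maximalIdeal V)
      (Module.Finite.fg_top) (IsLocalRing.jacobson_eq_maximalIdeal ⊥ bot_ne_top).ge ?_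
    intro x _
    refine Submodule.mem_sup.2 ⟨θV x, ⟨x, rfl⟩, ϖ • k x,
      Submodule.smul_mem_smul hϖ trivial, ?_⟩
    change θ x + _ = x
    rw [hθ, sub_add_cancel]
  have hinj : Function.Injective θV := IsNoetherian.injective_of_surjective_endomorphism θV hsurj
  let E : N ≃ₗ[A] N := LinearEquiv.ofBijective θ ⟨hinj, hsurj⟩
  -- `E⁻¹ r` is a retraction of `P` onto `N`, so that `p` has a section.
  have hret : ∀ x : N, E.symm (r x) = x := fun x ↦ E.symm_apply_apply x
  let t : P →ₗ[A] P := LinearMap.id - N.subtype.comp (E.symm.toLinearMap.comp r)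
  have ht : LinearMap.ker p ≤ LinearMap.ker t := fun x hx ↦ by
    have := hret ⟨x, hx⟩
    simp only [t, LinearMap.mem_ker, LinearMap.sub_apply, LinearMap.id_apply,
      LinearMap.comp_apply, LinearEquiv.coe_coe]
    rw [this]
    simp
  let sec : L →ₗ[A] P := ((LinearMap.ker p).liftQ t ht).comp
    (p.quotKerEquivOfSurjective hp).symm.toLinearMap
  refine Module.Projective.of_split sec p ?_
  ext x
  obtain ⟨y, rfl⟩ := hp x
  have h1 : (p.quotKerEquivOfSurjective hp).symm (p y) = (LinearMap.ker p).mkQ y := by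
    rw [LinearEquiv.symm_apply_eq]; rfl
  have h2 : p (E.symm (r y)) = 0 := (E.symm (r y)).2
  simp only [sec, LinearMap.comp_apply, LinearEquiv.coe_coe, h1, LinearMap.id_apply]
  change p (t y) = p y
  simp [t, h2]

/-- A finite algebra `A` over a Noetherian local ring in which every left ideal is projective: it
suffices that `A` has a projective two-sided ideal `J` with semisimple quotient, a power of which
is contained in `ϖ A` for a regular element `ϖ` of the maximal ideal. -/
theorem Ideal.projective_of_isSemisimpleRing_quotient {A : Type u} [Ring A] [Algebra V A]
    [Module.Finite V A] {ϖ : V} (hϖ : ϖ ∈ IsLocalRing.maximalIdeal V)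
    (hreg : ∀ x : A, ϖ • x = 0 → x = 0) (J : Ideal A) [J.IsTwoSided]
    [IsSemisimpleRing (A ⧸ J)] [Module.Projective A J] (n : ℕ)
    (hJ : ∀ a ∈ J ^ n, ∃ b : A, a = ϖ • b) (L : Ideal A) : Module.Projective A L := by
  have : IsNoetherianRing A := isNoetherian_of_tower V
    (isNoetherian_of_isNoetherianRing_of_finite V A)
  obtain ⟨k, p, hp⟩ := Module.Finite.exists_fin' A L
  let m : L →ₗ[A] L := DistribSMul.toLinearMap A L ϖ
  refine Module.Projective.of_projective_comap_range_smul hϖ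
    (fun x hx ↦ Subtype.ext (hreg _ (congrArg Subtype.val hx))) p hp m (fun _ ↦ rfl) ?_
  have hker := HasProjectiveKernels.of_isTorsionBySet_pow.{u} J n (X := L ⧸ LinearMap.range m) ?_ _
    ((LinearMap.range m).mkQ.comp p) ((Submodule.mkQ_surjective _).comp hp)
  · rwa [LinearMap.ker_comp, Submodule.ker_mkQ] at hker
  · intro a ha x
    obtain ⟨b, rfl⟩ := hJ a ha
    induction x using Submodule.Quotient.induction_on with | _ x =>
    refine (Submodule.Quotient.mk_eq_zero _).2 ⟨b • x, ?_⟩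
    exact (smul_assoc ϖ b x).symm

end Criterion

/-! ### The order of a two-cocycle at a prime ideal -/

namespace NormalizedTwoCocycle

variable {G R : Type*} [Group G] [CommRing R] [MulSemiringAction G R]
  (f : NormalizedTwoCocycle G R)

theorem val_mul_inv_self (σ : G) : f.val σ σ⁻¹ = σ • f.val σ⁻¹ σ := by
  simpa [f.one_left, f.one_right] using (f.cocycle σ σ⁻¹ σ).symm

theorem val_inv_mul (ρ σ : G) : (ρ • f.val ρ⁻¹ (ρ * σ)) * f.val ρ σ = f.val ρ ρ⁻¹ := by
  simpa [f.one_left] using f.cocycle ρ ρ⁻¹ (ρ * σ)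

theorem val_mul_val_mul_inv (σ τ : G) :
    f.val σ τ * f.val (σ * τ) (σ * τ)⁻¹ = (σ • f.val τ (σ * τ)⁻¹) * f.val σ σ⁻¹ := by
  simpa using (f.cocycle σ τ (σ * τ)⁻¹).symm

theorem val_mul_val_mul_inv' (τ σ : G) :
    f.val τ σ * f.val (τ * σ) (τ * σ)⁻¹ =
      τ • ((σ • f.val (τ * σ)⁻¹ τ) * f.val σ σ⁻¹) := by
  have h := f.cocycle σ (τ * σ)⁻¹ τ
  have h1 : (τ * σ)⁻¹ * τ = σ⁻¹ := by group
  have h2 : σ * (τ * σ)⁻¹ = τ⁻¹ := by group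
  rw [h1, h2] at h
  rw [val_mul_val_mul_inv, h, smul_mul', f.val_mul_inv_self τ]

theorem val_mul_val_comm (ρ σ : G) :
    f.val ρ (ρ⁻¹ * σ) * f.val σ (σ⁻¹ * ρ) = ρ • f.val (ρ⁻¹ * σ) (ρ⁻¹ * σ)⁻¹ := by
  have h := f.cocycle ρ (ρ⁻¹ * σ) (σ⁻¹ * ρ)
  have h1 : ρ⁻¹ * σ * (σ⁻¹ * ρ) = 1 := by group
  have h2 : (ρ⁻¹ * σ)⁻¹ = σ⁻¹ * ρ := by group
  rw [h1, mul_inv_cancel_left, f.one_right, mul_one] at h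
  rw [h2, h]

/-- The relation `ρ ≤ σ` on `G` at a prime `M`: the coefficient of `x_ρ x_{ρ⁻¹σ}` at `x_σ` is a
unit at `M`, so that locally `x_σ` is a right multiple of `x_ρ`. -/
def Le (M : Ideal R) (ρ σ : G) : Prop := f.val ρ (ρ⁻¹ * σ) ∉ M

variable {f} {M : Ideal R}

theorem Le.trans [M.IsPrime] {ρ σ τ : G} (h₁ : f.Le M ρ σ) (h₂ : f.Le M σ τ) : f.Le M ρ τ := by
  intro h
  have hc := f.cocycle ρ (ρ⁻¹ * σ) (σ⁻¹ * τ)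
  have h1 : ρ⁻¹ * σ * (σ⁻¹ * τ) = ρ⁻¹ * τ := by group
  rw [h1, mul_inv_cancel_left] at hc
  exact (Ideal.IsPrime.mem_or_mem ‹_› (hc ▸ M.mul_mem_left _ h)).elim h₁ h₂

theorem Le.refl [M.IsPrime] (σ : G) : f.Le M σ σ := by
  rw [Le, inv_mul_cancel, f.one_right]
  exact (Ideal.ne_top_iff_one M).1 ‹M.IsPrime›.ne_top

theorem le_mul_iff {σ τ : G} : f.Le M σ (σ * τ) ↔ f.val σ τ ∉ M := by
  rw [Le, inv_mul_cancel_left]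

/-- If the square of no maximal ideal contains a value `f(τ, τ⁻¹)`, the relation is total. -/
theorem le_total (hf : ∀ (τ : G) (M : Ideal R), M.IsMaximal → f.val τ τ⁻¹ ∉ M ^ 2)
    [hM : M.IsMaximal] (ρ σ : G) : f.Le M ρ σ ∨ f.Le M σ ρ := by
  by_contra! h
  have h1 : f.val ρ (ρ⁻¹ * σ) ∈ M := not_not.1 h.1
  have h2 : f.val σ (σ⁻¹ * ρ) ∈ M := not_not.1 h.2
  -- The product `ρ(f(τ, τ⁻¹))` of the two values, where `τ = ρ⁻¹σ`, lies in `M ^ 2`; the maximal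
  -- ideal that violates the hypothesis is `ρ⁻¹ M`.
  let e : R ≃+* R := (MulSemiringAction.toRingEquiv G R ρ).symm
  have hmax : (M.map (e : R →+* R)).IsMaximal := Ideal.map_isMaximal_of_equiv e
  refine hf (ρ⁻¹ * σ) _ hmax ?_
  rw [← Ideal.map_pow]
  have h3 := Ideal.mem_map_of_mem (e : R →+* R) (Ideal.mul_mem_mul h1 h2)
  rw [f.val_mul_val_comm, ← pow_two] at h3
  exact (inv_smul_smul ρ (f.val (ρ⁻¹ * σ) (ρ⁻¹ * σ)⁻¹)) ▸ h3

/-- The number of elements of `G` strictly below `σ`. -/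
noncomputable def depth (f : NormalizedTwoCocycle G R) (M : Ideal R) (σ : G) : ℕ :=
  {ρ | f.Le M ρ σ ∧ ¬ f.Le M σ ρ}.ncard

theorem depth_lt_depth [Finite G] [M.IsPrime] {σ τ : G} (h : f.Le M σ τ) (h' : ¬ f.Le M τ σ) :
    f.depth M σ < f.depth M τ :=
  Set.ncard_lt_ncard
    ⟨fun _ hρ ↦ ⟨hρ.1.trans h, fun hτ ↦ h' (hτ.trans hρ.1)⟩, fun hs ↦ (hs ⟨h, h'⟩).2 (.refl σ)⟩
    (Set.toFinite _)

theorem depth_lt_card [Finite G] [M.IsPrime] (σ : G) : f.depth M σ < Nat.card G := by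
  rw [← Set.ncard_univ]
  exact Set.ncard_lt_ncard ⟨Set.subset_univ _, fun h ↦ (h (Set.mem_univ σ)).2 (.refl σ)⟩
    (Set.toFinite _)

theorem exists_forall_le [Finite G]
    (hf : ∀ (τ : G) (M : Ideal R), M.IsMaximal → f.val τ τ⁻¹ ∉ M ^ 2)
    (M : Ideal R) [M.IsMaximal] : ∃ σ : G, ∀ ρ, f.Le M ρ σ := by
  obtain ⟨σ, hσ⟩ := Finite.exists_max (f.depth M)
  refine ⟨σ, fun ρ ↦ by_contra fun h ↦ ?_⟩
  exact (hσ ρ).not_gt (depth_lt_depth ((le_total hf ρ σ).resolve_left h) h)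

/-- The cocycle of the opposite of the crossed product of `f`, with respect to `σ ↦ x_{σ⁻¹}`. -/
def opposite (f : NormalizedTwoCocycle G R) : NormalizedTwoCocycle G R where
  val σ τ := (σ * τ) • f.val τ⁻¹ σ⁻¹
  cocycle σ τ ρ := by
    have h := congrArg ((σ * τ * ρ) • ·) (f.cocycle ρ⁻¹ τ⁻¹ σ⁻¹)
    simp only [smul_mul', smul_smul, mul_inv_cancel_right] at h
    simp only [smul_smul, mul_inv_rev, mul_assoc] at h ⊢
    rw [← h, mul_comm]
  one_left σ := by simp [f.one_right]
  one_right σ := by simp [f.one_left]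

theorem opposite_val_inv (f : NormalizedTwoCocycle G R) (σ : G) :
    f.opposite.val σ σ⁻¹ = f.val σ σ⁻¹ := by
  simp [opposite]

end NormalizedTwoCocycle

/-! ### Coefficients in the crossed product -/

namespace CrossedProduct

variable {G R : Type*} [Group G] [CommRing R] [MulSemiringAction G R]
  {f : NormalizedTwoCocycle G R}

section Coefficients

/-- The coefficient at `x_σ`. -/
def coeff (σ : G) : CrossedProduct f →+ R := Finsupp.applyAddHom (M := R) σ

theorem ext_coeff {a b : CrossedProduct f} (h : ∀ σ, coeff σ a = coeff σ b) : a = b :=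
  Finsupp.ext (M := R) h

theorem coeff_single_self (σ : G) (s : R) : coeff σ (single f σ s) = s :=
  Finsupp.single_eq_same (M := R)

theorem coeff_single_of_ne {σ τ : G} (h : τ ≠ σ) (s : R) : coeff τ (single f σ s) = 0 :=
  Finsupp.single_eq_of_ne (M := R) h

theorem coeff_single_mul (ρ σ : G) (s : R) (a : CrossedProduct f) :
    coeff ρ (single f σ s * a) = s * (σ • coeff (σ⁻¹ * ρ) a) * f.val σ (σ⁻¹ * ρ) := by
  induction a using induction with
  | add a b ha hb => simp only [mul_add, map_add, ha, hb, smul_add, add_mul]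
  | single τ t =>
    rw [single_mul_single]
    by_cases h : τ = σ⁻¹ * ρ
    · subst h
      rw [mul_inv_cancel_left, coeff_single_self, coeff_single_self]
    · rw [coeff_single_of_ne (Ne.symm h), coeff_single_of_ne, smul_zero, mul_zero, zero_mul]
      rintro rfl
      exact h (inv_mul_cancel_left σ τ).symm

theorem coeff_mul_single (ρ τ : G) (t : R) (a : CrossedProduct f) :
    coeff ρ (a * single f τ t) =
      coeff (ρ * τ⁻¹) a * ((ρ * τ⁻¹) • t) * f.val (ρ * τ⁻¹) τ := by
  induction a using induction with
  | add a b ha hb => simp only [map_add, ha, hb, add_mul]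
  | single σ s =>
    rw [single_mul_single]
    by_cases h : σ = ρ * τ⁻¹
    · subst h
      rw [inv_mul_cancel_right, coeff_single_self, coeff_single_self]
    · rw [coeff_single_of_ne (Ne.symm h), coeff_single_of_ne, zero_mul, zero_mul]
      rintro rfl
      exact h (mul_inv_cancel_right σ τ).symm

theorem coeff_mul [Fintype G] (ρ : G) (a b : CrossedProduct f) :
    coeff ρ (a * b) = ∑ σ, coeff σ a * (σ • coeff (σ⁻¹ * ρ) b) * f.val σ (σ⁻¹ * ρ) := by
  induction a using induction with
  | add a b ha hb => simp only [map_add, ha, hb, add_mul, Finset.sum_add_distrib]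
  | single τ t =>
    rw [coeff_single_mul, Finset.sum_eq_single τ, coeff_single_self]
    · intro σ _ h
      rw [coeff_single_of_ne h, zero_mul, zero_mul]
    · simp

theorem coeff_single_one_mul (ρ : G) (s : R) (a : CrossedProduct f) :
    coeff ρ (single f 1 s * a) = s * coeff ρ a := by
  simp [coeff_single_mul, f.one_left]

theorem coeff_mul_single_one (ρ : G) (s : R) (a : CrossedProduct f) :
    coeff ρ (a * single f 1 s) = coeff ρ a * (ρ • s) := by
  simp [coeff_mul_single, f.one_right]

theorem single_one_pow (s : R) (n : ℕ) : single f 1 s ^ n = single f 1 (s ^ n) := by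
  induction n with
  | zero => simp [one_def]
  | succ n ih => rw [pow_succ, ih, single_mul_single]; simp [f.one_right, pow_succ]

theorem single_one_mul_comm {ϖ : R} (hfix : ∀ σ : G, σ • ϖ = ϖ) (a : CrossedProduct f) :
    single f 1 ϖ * a = a * single f 1 ϖ :=
  ext_coeff fun σ ↦ by rw [coeff_single_one_mul, coeff_mul_single_one, hfix, mul_comm]

theorem mul_single_one_injective [IsDomain R] {ϖ : R} (hϖ : ϖ ≠ 0) (hfix : ∀ σ : G, σ • ϖ = ϖ)
    {a b : CrossedProduct f} (h : a * single f 1 ϖ = b * single f 1 ϖ) : a = b :=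
  ext_coeff fun σ ↦ by
    have := congrArg (coeff σ) h
    rw [coeff_mul_single_one, coeff_mul_single_one, hfix] at this
    exact mul_right_cancel₀ hϖ this

theorem exists_coeff_eq_mul_of_forall_dvd [Finite G] {ϖ : R} {a : CrossedProduct f}
    (h : ∀ σ, ϖ ∣ coeff σ a) : ∃ b : CrossedProduct f, ∀ σ, coeff σ a = ϖ * coeff σ b := by
  choose c hc using h
  exact ⟨(Finsupp.equivFunOnFinite.symm c : G →₀ R), hc⟩

end Coefficients

section Algebra

variable {V : Type*} [CommRing V] [Algebra V R]

noncomputable instance : Module V (CrossedProduct f) := inferInstanceAs (Module V (G →₀ R))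

theorem coeff_smul (v : V) (σ : G) (a : CrossedProduct f) :
    coeff σ (v • a) = algebraMap V R v * coeff σ a :=
  Algebra.smul_def v _

noncomputable instance [SMulCommClass G V R] : Algebra V (CrossedProduct f) :=
  Algebra.ofModule
    (fun v a b ↦ by
      induction a using induction with
      | add a a' ha ha' => rw [smul_add, add_mul, ha, ha', add_mul, smul_add]
      | single σ s =>
        have : v • single f σ s = single f σ (v • s) := Finsupp.smul_single (M := R) v σ s
        rw [this]
        exact ext_coeff fun ρ ↦ by
          simp only [coeff_smul, coeff_single_mul, Algebra.smul_def, mul_assoc])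
    (fun v a b ↦ by
      induction a using induction with
      | add a a' ha ha' => rw [add_mul, ha, ha', add_mul, smul_add]
      | single σ s =>
        exact ext_coeff fun ρ ↦ by
          simp only [coeff_smul, coeff_single_mul, smul_mul', smul_algebraMap]
          ring)

instance [Finite G] [Module.Finite V R] : Module.Finite V (CrossedProduct f) :=
  inferInstanceAs (Module.Finite V (G →₀ R))

end Algebra

/-! ### The radical of the trace form -/

section TraceRadical

/-- The elements `a` such that `ϖ` divides the coefficient at `x_1` of every `a b` (equivalently,
of every `b a`); in terms of the coefficients, `ϖ` divides `a_σ f(σ, σ⁻¹)` for all `σ`. -/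
def traceRadical (f : NormalizedTwoCocycle G R) {ϖ : R} (hfix : ∀ σ : G, σ • ϖ = ϖ) :
    Ideal (CrossedProduct f) where
  carrier := {a | ∀ σ, ϖ ∣ coeff σ a * f.val σ σ⁻¹}
  add_mem' ha hb σ := by rw [map_add, add_mul]; exact dvd_add (ha σ) (hb σ)
  zero_mem' σ := by rw [map_zero, zero_mul]; exact dvd_zero _
  smul_mem' c a ha := by
    induction c using induction with
    | add c d hc hd =>
      intro σ
      rw [smul_eq_mul, add_mul, map_add, add_mul]
      exact dvd_add (hc σ) (hd σ)
    | single τ t =>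
      intro ρ
      obtain ⟨σ, rfl⟩ : ∃ σ, ρ = τ * σ := ⟨τ⁻¹ * ρ, by group⟩
      rw [smul_eq_mul, coeff_single_mul, inv_mul_cancel_left, mul_assoc,
        f.val_mul_val_mul_inv', mul_assoc, ← smul_mul', mul_left_comm (coeff σ a)]
      obtain ⟨y, hy⟩ := ha σ
      refine Dvd.intro (t * (τ • ((σ • f.val (τ * σ)⁻¹ τ) * y))) ?_
      rw [hy, smul_mul', smul_mul', smul_mul', hfix]
      ring

variable {ϖ : R} {hfix : ∀ σ : G, σ • ϖ = ϖ}

theorem mem_traceRadical {a : CrossedProduct f} :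
    a ∈ traceRadical f hfix ↔ ∀ σ, ϖ ∣ coeff σ a * f.val σ σ⁻¹ := Iff.rfl

instance : (traceRadical f hfix).IsTwoSided := ⟨fun {a} c ha ↦ by
  induction c using induction with
  | add c d hc hd => rw [mul_add]; exact add_mem hc hd
  | single τ t =>
    intro ρ
    obtain ⟨σ, rfl⟩ : ∃ σ, ρ = σ * τ := ⟨ρ * τ⁻¹, by group⟩
    rw [coeff_mul_single, mul_inv_cancel_right, mul_assoc, f.val_mul_val_mul_inv]
    obtain ⟨y, hy⟩ := ha σ
    refine Dvd.intro (y * (σ • t) * σ • f.val τ (σ * τ)⁻¹) ?_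
    linear_combination (-(σ • t) * (σ • f.val τ (σ * τ)⁻¹)) * hy⟩

theorem single_one_mem_traceRadical {s : R} :
    single f 1 s ∈ traceRadical f hfix ↔ ϖ ∣ s := by
  refine ⟨fun h ↦ by simpa [coeff_single_self, f.one_left] using h 1, fun h σ ↦ ?_⟩
  by_cases hσ : σ = 1
  · subst hσ
    rw [coeff_single_self]
    exact h.mul_right _
  · rw [coeff_single_of_ne hσ, zero_mul]
    exact dvd_zero _

/-- A power of `traceRadical` is contained in `ϖ A`: at a maximal ideal `M`, the elements of its
`k`-th power involve only those `x_σ` that have at least `k` elements of `G` below them. -/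
theorem dvd_coeff_of_mem_traceRadical_pow [Finite G]
    (hrad : ∀ s : R, ϖ ∣ s ↔ ∀ M : Ideal R, M.IsMaximal → s ∈ M) {a : CrossedProduct f}
    (ha : a ∈ traceRadical f hfix ^ Nat.card G) (σ : G) : ϖ ∣ coeff σ a := by
  have key : ∀ k : ℕ, ∀ a ∈ traceRadical f hfix ^ k, ∀ M : Ideal R, M.IsMaximal → ∀ σ,
      coeff σ a ∉ M → k ≤ f.depth M σ := by
    have := Fintype.ofFinite G
    intro k
    induction k with
    | zero => intros; exact Nat.zero_le _
    | succ k ih =>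
      intro a ha M hM
      rw [Submodule.pow_succ] at ha
      refine Submodule.smul_induction_on (p := fun a ↦ ∀ σ, coeff σ a ∉ M → k + 1 ≤ f.depth M σ)
        ha (fun a ha b hb ρ hρ ↦ ?_) (fun a b ha hb ρ hρ ↦ ?_)
      · rw [smul_eq_mul, coeff_mul] at hρ
        obtain ⟨σ, -, hσ⟩ : ∃ σ ∈ Finset.univ,
            coeff σ a * (σ • coeff (σ⁻¹ * ρ) b) * f.val σ (σ⁻¹ * ρ) ∉ M := by
          by_contra! h
          exact hρ (Ideal.sum_mem _ h)
        obtain ⟨τ, rfl⟩ : ∃ τ, ρ = σ * τ := ⟨σ⁻¹ * ρ, by group⟩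
        rw [inv_mul_cancel_left] at hσ
        have h1 : coeff σ a ∉ M := fun h ↦ hσ (M.mul_mem_right _ (M.mul_mem_right _ h))
        have h2 : σ • coeff τ b ∉ M := fun h ↦ hσ (M.mul_mem_right _ (M.mul_mem_left _ h))
        have h3 : f.val σ τ ∉ M := fun h ↦ hσ (M.mul_mem_left _ h)
        refine (Nat.succ_le_succ (ih a ha M hM σ h1)).trans
          (NormalizedTwoCocycle.depth_lt_depth (f.le_mul_iff.2 h3) fun h4 ↦ ?_)
        -- `ϖ` divides `b_τ f(τ, τ⁻¹)`, and `b_τ ∉ σ⁻¹ M`; hence `f(τ, τ⁻¹) ∈ σ⁻¹ M`.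
        obtain ⟨y, hy⟩ := hb τ
        have h5 := congrArg (σ • ·) hy
        simp only [smul_mul', hfix] at h5
        have h6 : σ • f.val τ τ⁻¹ ∈ M := by
          have : (σ • coeff τ b) * (σ • f.val τ τ⁻¹) ∈ M := by
            rw [h5]
            exact M.mul_mem_right _ ((hrad ϖ).1 dvd_rfl M hM)
          exact (hM.isPrime.mem_or_mem this).resolve_left h2
        have h7 := f.cocycle σ τ τ⁻¹
        rw [mul_inv_cancel, f.one_right, mul_one] at h7
        have h8 : f.val (σ * τ) τ⁻¹ ∈ M := by
          rw [h7] at h6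
          exact (hM.isPrime.mem_or_mem h6).resolve_left h3
        refine h4 ?_
        have h9 : (σ * τ)⁻¹ * σ = τ⁻¹ := by group
        rwa [h9]
      · rw [map_add] at hρ
        by_cases h : coeff ρ a ∈ M
        · exact hb ρ fun h' ↦ hρ (add_mem h h')
        · exact ha ρ h
  refine (hrad _).2 fun M hM ↦ by_contra fun h ↦ ?_
  exact (key _ a ha M hM σ h).not_gt (NormalizedTwoCocycle.depth_lt_card σ)

/-- The quotient by `traceRadical` has no nonzero nilpotent ideal, because the inertia groups are
trivial: with an element `a`, an ideal contains, for every maximal ideal `M`, an element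
`a_1 u x_1` with `u ∉ M`. -/
theorem isSemisimpleRing_quotient_traceRadical [Finite G]
    (hrad : ∀ s : R, ϖ ∣ s ↔ ∀ M : Ideal R, M.IsMaximal → s ∈ M)
    (hinert : ∀ (M : Ideal R), M.IsMaximal → ∀ σ : G, σ ≠ 1 → ∃ s : R, σ • s - s ∉ M)
    [IsArtinianRing (CrossedProduct f ⧸ traceRadical f hfix)] :
    IsSemisimpleRing (CrossedProduct f ⧸ traceRadical f hfix) := by
  rw [IsArtinianRing.isSemisimpleRing_iff_jacobson, eq_bot_iff]
  set J := traceRadical f hfix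
  intro x hx
  obtain ⟨a, rfl⟩ := Ideal.Quotient.mk_surjective x
  refine Ideal.Quotient.eq_zero_iff_mem.2 (mem_traceRadical.2 fun σ ↦ (hrad _).2 fun M hM ↦ ?_)
  by_contra hσ
  let I := (Ring.jacobson (CrossedProduct f ⧸ J)).comap (Ideal.Quotient.mk J)
  have hI : ∀ a ∈ I, ∀ c, a * c ∈ I := fun a ha c ↦ by
    change Ideal.Quotient.mk J (a * c) ∈ Ring.jacobson (CrossedProduct f ⧸ J)
    rw [map_mul]
    exact Ideal.mul_mem_right _ _ ha
  have key : ∀ T : Finset G, 1 ∉ T → ∃ c ∈ I, coeff 1 c ∉ M ∧ ∀ σ ∈ T, coeff σ c = 0 := by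
    classical
    intro T
    induction T using Finset.induction_on with
    | empty =>
      intro _
      refine ⟨a * single f σ⁻¹ 1, hI a hx _, ?_, by simp⟩
      rw [coeff_mul_single]
      simpa using hσ
    | insert σ T _ ih =>
      intro hT
      obtain ⟨c, hc, hc1, hcT⟩ := ih fun h ↦ hT (Finset.mem_insert_of_mem h)
      have hne : σ ≠ 1 := by rintro rfl; exact hT (Finset.mem_insert_self _ _)
      obtain ⟨s, hs⟩ := hinert M hM σ hne
      have hcoeff : ∀ ρ, coeff ρ (c * single f 1 s - single f 1 (σ • s) * c) =
          coeff ρ c * (ρ • s - σ • s) := fun ρ ↦ by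
        rw [map_sub, coeff_mul_single_one, coeff_single_one_mul]
        ring
      -- `c s - σ(s) c` has no coefficient at `x_σ`, and its coefficient at `x_1` is still a unit
      -- at `M`.
      refine ⟨c * single f 1 s - single f 1 (σ • s) * c,
        sub_mem (hI c hc _) (I.mul_mem_left _ hc), ?_, ?_⟩
      · rw [hcoeff, one_smul, ← neg_sub, mul_neg, neg_mem_iff]
        exact fun h ↦ (hM.isPrime.mem_or_mem h).elim hc1 hs
      · intro ρ hρ
        rw [hcoeff]
        obtain rfl | hρ := Finset.mem_insert.1 hρ
        · rw [sub_self, mul_zero]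
        · rw [hcT ρ hρ, zero_mul]
  have := Fintype.ofFinite G
  classical
  obtain ⟨c, hcI, hc1, hc⟩ := key (Finset.univ.erase 1) (by simp)
  have hc' : c = single f 1 (coeff 1 c) := ext_coeff fun σ ↦ by
    by_cases hσ : σ = 1
    · subst hσ
      rw [coeff_single_self]
    · rw [coeff_single_of_ne hσ, hc σ (by simp [hσ])]
  obtain ⟨n, hn⟩ := IsSemiprimaryRing.isNilpotent (R := CrossedProduct f ⧸ J)
  have hpow : ∀ k : ℕ, Ideal.Quotient.mk J c ^ k ∈ Ring.jacobson (CrossedProduct f ⧸ J) ^ k := by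
    intro k
    induction k with
    | zero => rw [Submodule.pow_zero, Ideal.one_eq_top]; trivial
    | succ k ih =>
      rw [Submodule.pow_succ, pow_succ]
      exact Ideal.mul_mem_mul ih hcI
  have h0 := hpow n
  rw [hn, ← map_pow, hc', single_one_pow] at h0
  have h1 := (hrad _).1 (single_one_mem_traceRadical.1 (Ideal.Quotient.eq_zero_iff_mem.1 h0)) M hM
  exact hc1 (hM.isPrime.mem_of_pow_mem n h1)

/-- Let `s_σ = ∏_ρ f(ρ, ρ⁻¹σ)`. If `y` lies in `traceRadical` then `y s_σ x_σ` is divisible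
by `ϖ`, so that right multiplication by `s_σ` factors through the free module `A`: it is
`y ↦ (y s_σ x_σ / ϖ) (ϖ x_σ⁻¹)`, where `ϖ x_σ⁻¹ = t x_{σ⁻¹}` if
`f(σ⁻¹, σ) t = ϖ`. For a greatest `σ` in the order at a maximal ideal `M`, the element `s_σ` does
not lie in `M`. Hence the `s_σ` generate the unit ideal, and the identity is a combination of such
maps. -/
theorem projective_traceRadical [IsDomain R] [Finite G] (hϖ : ϖ ≠ 0)
    (hdvd : ∀ τ : G, f.val τ τ⁻¹ ∣ ϖ)
    (hf : ∀ (τ : G) (M : Ideal R), M.IsMaximal → f.val τ τ⁻¹ ∉ M ^ 2) :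
    Module.Projective (CrossedProduct f) (traceRadical f hfix) := by
  have := Fintype.ofFinite G
  set J := traceRadical f hfix
  choose t ht using hdvd
  let s : G → R := fun σ ↦ ∏ ρ, f.val ρ (ρ⁻¹ * σ)
  have hspan : Ideal.span (Set.range s) = ⊤ := by
    by_contra h
    obtain ⟨M, hM, hle⟩ := Ideal.exists_le_maximal _ h
    obtain ⟨σ, hσ⟩ := NormalizedTwoCocycle.exists_forall_le hf M
    obtain ⟨ρ, -, hρ⟩ := hM.isPrime.prod_mem_iff.1 (hle (Ideal.subset_span ⟨σ, rfl⟩))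
    exact hσ ρ hρ
  obtain ⟨u, hu⟩ := Ideal.mem_span_range_iff_exists_fun.1
    (hspan ▸ Submodule.mem_top : (1 : R) ∈ Ideal.span (Set.range s))
  let m : CrossedProduct f →ₗ[CrossedProduct f] CrossedProduct f :=
    LinearMap.toSpanSingleton _ _ (single f 1 ϖ)
  have hm : ∀ a, m a = a * single f 1 ϖ := fun _ ↦ rfl
  have hminj : Function.Injective m := fun a b h ↦ mul_single_one_injective hϖ hfix h
  have hex : ∀ σ, ∃ φ : J →ₗ[CrossedProduct f] CrossedProduct f,
      ∀ y, m (φ y) = y * single f σ (s σ) := fun σ ↦ by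
    refine LinearMap.exists_comp_eq_of_forall_mem_range
      ((LinearMap.toSpanSingleton _ _ (single f σ (s σ))).comp J.subtype) m hminj fun y ↦ ?_
    obtain ⟨b, hb⟩ := exists_coeff_eq_mul_of_forall_dvd (ϖ := ϖ)
      (a := (y : CrossedProduct f) * single f σ (s σ)) fun κ ↦ by
      obtain ⟨ρ, rfl⟩ : ∃ ρ, κ = ρ * σ := ⟨κ * σ⁻¹, by group⟩
      rw [coeff_mul_single, mul_inv_cancel_right]
      obtain ⟨s', hs'⟩ : f.val ρ⁻¹ (ρ * σ) ∣ s σ := by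
        simpa using Finset.dvd_prod_of_mem (fun ρ ↦ f.val ρ (ρ⁻¹ * σ)) (Finset.mem_univ ρ⁻¹)
      refine (mem_traceRadical.1 y.2 ρ).trans (Dvd.intro (ρ • s') ?_)
      rw [hs', smul_mul', ← f.val_inv_mul ρ σ]
      ring
    refine ⟨b, ext_coeff fun κ ↦ ?_⟩
    rw [hm, coeff_mul_single_one, hfix, mul_comm]
    exact (hb κ).symm
  choose φ hφ using hex
  have htmem : ∀ σ, single f σ⁻¹ (t σ⁻¹) * single f 1 (u σ) ∈ J := fun σ ↦ by
    refine Ideal.mul_mem_right _ _ fun ρ ↦ ?_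
    by_cases h : ρ = σ⁻¹
    · subst h
      rw [coeff_single_self, mul_comm, ← ht]
    · rw [coeff_single_of_ne h, zero_mul]
      exact dvd_zero _
  let Φ : J →ₗ[CrossedProduct f] (G → CrossedProduct f) := LinearMap.pi φ
  let Ψ : (G → CrossedProduct f) →ₗ[CrossedProduct f] J :=
    ∑ σ, (LinearMap.toSpanSingleton _ J ⟨_, htmem σ⟩).comp (LinearMap.proj σ)
  refine Module.Projective.of_split Φ Ψ (LinearMap.ext fun y ↦ Subtype.ext ?_)
  have hΨ : ((Ψ (Φ y) : J) : CrossedProduct f) =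
      ∑ σ, φ σ y * (single f σ⁻¹ (t σ⁻¹) * single f 1 (u σ)) := by
    simp [Ψ, Φ]
  have hterm : ∀ σ, φ σ y * (single f σ⁻¹ (t σ⁻¹) * single f 1 (u σ)) * single f 1 ϖ =
      y * single f 1 (u σ * s σ) * single f 1 ϖ := fun σ ↦ by
    have h1 : (σ • t σ⁻¹) * f.val σ σ⁻¹ = ϖ := by
      rw [f.val_mul_inv_self, ← smul_mul', mul_comm]
      have := ht σ⁻¹
      rw [inv_inv] at this
      rw [← this, hfix]
    rw [mul_assoc, ← single_one_mul_comm hfix, ← mul_assoc, ← hm, hφ, mul_assoc, mul_assoc,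
      ← mul_assoc (single f σ _), single_mul_single, single_mul_single, single_mul_single]
    congr 2
    · simp
    · simp only [mul_inv_cancel, one_smul, f.one_left, mul_one]
      linear_combination (s σ * u σ) * h1
  apply mul_single_one_injective hϖ hfix
  change ((Ψ (Φ y) : J) : CrossedProduct f) * _ = y * _
  rw [hΨ, Finset.sum_mul, Finset.sum_congr rfl fun σ _ ↦ hterm σ, ← Finset.sum_mul,
    ← Finset.mul_sum, ← map_sum, hu, ← one_def, mul_one]

end TraceRadical

/-! ### Necessity of the condition -/

section Necessity

/-- If the left ideal generated by `ϖ` and `x_{τ⁻¹}` is projective, then `f(τ, τ⁻¹)` divides `ϖ`.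
A section of `A² → Aϖ + Ax_{τ⁻¹}` yields `ϖ = d₁ ϖ + d₂ x_{τ⁻¹}` with `x_{τ⁻¹} d₁ ∈ ϖ A`, and the
coefficients at `x_1` show that `f(τ, τ⁻¹)` divides `ϖ` times a unit. -/
theorem val_mul_inv_dvd_of_projective {ϖ : R}
    (hfix : ∀ σ : G, σ • ϖ = ϖ) (hjac : ∀ M : Ideal R, M.IsMaximal → ϖ ∈ M)
    (h : ∀ L : Ideal (CrossedProduct f), Module.Projective (CrossedProduct f) L) (τ : G) :
    f.val τ τ⁻¹ ∣ ϖ := by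
  let p := single f 1 ϖ
  let x := single f τ⁻¹ 1
  have hcomm : ∀ a, p * a = a * p := single_one_mul_comm hfix
  let L : Ideal (CrossedProduct f) := Ideal.span {p, x}
  have hp : p ∈ L := Ideal.subset_span (by simp)
  have hx : x ∈ L := Ideal.subset_span (by simp)
  have := h L
  let g : CrossedProduct f × CrossedProduct f →ₗ[CrossedProduct f] L :=
    (LinearMap.toSpanSingleton _ L ⟨p, hp⟩).coprod (LinearMap.toSpanSingleton _ L ⟨x, hx⟩)
  have hg : ∀ a b, (g (a, b) : CrossedProduct f) = a * p + b * x := fun a b ↦ by simp [g]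
  obtain ⟨s, hs⟩ := Module.projective_lifting_property g LinearMap.id fun y ↦ by
    obtain ⟨a, b, hab⟩ := Ideal.mem_span_pair.1 y.2
    exact ⟨(a, b), Subtype.ext (by rw [hg, hab])⟩
  let d := s ⟨p, hp⟩
  have h1 : d.1 * p + d.2 * x = p := by
    rw [← hg]
    exact congrArg Subtype.val (LinearMap.congr_fun hs ⟨p, hp⟩)
  have h2 : x * d.1 = p * (s ⟨x, hx⟩).1 := by
    have h3 : x • (⟨p, hp⟩ : L) = p • ⟨x, hx⟩ := Subtype.ext (hcomm x).symm
    have h4 := congrArg (fun y ↦ (s y).1) h3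
    simp only [map_smul] at h4
    exact h4
  have h3 := congrArg (coeff τ⁻¹) h2
  rw [coeff_single_mul, coeff_single_one_mul, inv_mul_cancel, f.one_right, one_mul, mul_one] at h3
  have h4 : ϖ ∣ coeff 1 d.1 := Dvd.intro (τ • coeff τ⁻¹ (s ⟨x, hx⟩).1) <| by
    have := congrArg (τ • ·) h3
    simp only [smul_inv_smul, smul_mul', hfix] at this
    exact this.symm
  have h5 := congrArg (coeff 1) h1
  rw [map_add, coeff_mul_single_one, coeff_mul_single, coeff_single_self, one_smul, inv_inv,
    one_mul, smul_one, mul_one] at h5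
  have hunit : IsUnit (1 - coeff 1 d.1) := by
    by_contra hn
    obtain ⟨M, hM, hmem⟩ := exists_max_ideal_of_mem_nonunits hn
    have := add_mem hmem (M.mem_of_dvd h4 (hjac M hM))
    rw [sub_add_cancel] at this
    exact hM.ne_top ((Ideal.eq_top_iff_one M).2 this)
  refine (hunit.dvd_mul_right).1 (Dvd.intro_left (coeff τ d.2) ?_)
  linear_combination h5

end Necessity

/-! ### Right ideals and the opposite cocycle -/

section Opposite

/-- The crossed product of the opposite cocycle is the opposite ring, with `x_σ` corresponding to
`x_{σ⁻¹}`. -/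
noncomputable def oppositeEquiv (f : NormalizedTwoCocycle G R) :
    CrossedProduct f.opposite ≃+* (CrossedProduct f)ᵐᵒᵖ :=
  let φ : CrossedProduct f.opposite →+ (CrossedProduct f)ᵐᵒᵖ :=
    lift fun σ ↦ (MulOpposite.opAddEquiv.toAddMonoidHom.comp (single f σ⁻¹)).comp
      (DistribSMul.toAddMonoidHom R σ⁻¹)
  let ψ : CrossedProduct f →+ CrossedProduct f.opposite :=
    lift fun σ ↦ (single f.opposite σ⁻¹).comp (DistribSMul.toAddMonoidHom R σ⁻¹)
  have hφ : ∀ σ s, φ (single _ σ s) = MulOpposite.op (single f σ⁻¹ (σ⁻¹ • s)) := fun σ s ↦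
    lift_single _ σ s
  have hψ : ∀ σ s, ψ (single _ σ s) = single _ σ⁻¹ (σ⁻¹ • s) := fun σ s ↦ lift_single _ σ s
  have hψφ : ∀ a, ψ (φ a).unop = a := fun a ↦ by
    induction a using induction with
    | add a b ha hb => rw [map_add, MulOpposite.unop_add, map_add, ha, hb]
    | single σ s => rw [hφ, MulOpposite.unop_op, hψ, inv_inv, smul_inv_smul]
  have hφψ : ∀ a, (φ (ψ a)).unop = a := fun a ↦ by
    induction a using induction with
    | add a b ha hb => rw [map_add, map_add, MulOpposite.unop_add, ha, hb]
    | single σ s => rw [hψ, hφ, inv_inv, smul_inv_smul, MulOpposite.unop_op]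
  { toFun := φ
    invFun := fun a ↦ ψ a.unop
    left_inv := hψφ
    right_inv := fun a ↦ MulOpposite.unop_injective (hφψ a.unop)
    map_add' := map_add φ
    map_mul' := fun a b ↦ by
      induction a using induction with
      | add a a' ha ha' => rw [add_mul, map_add, ha, ha', map_add, add_mul]
      | single σ s =>
        induction b using induction with
        | add b b' hb hb' => rw [mul_add, map_add, hb, hb', map_add, mul_add]
        | single τ t =>
          rw [single_mul_single, hφ, hφ, hφ, ← MulOpposite.op_mul, single_mul_single,
            mul_inv_rev]
          congr 2
          simp only [NormalizedTwoCocycle.opposite, smul_mul', smul_smul, mul_assoc,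
            inv_mul_cancel_left, inv_mul_cancel, one_smul, mul_one]
          ring }

theorem projective_rightIdeal (f : NormalizedTwoCocycle G R)
    (h : ∀ L : Ideal (CrossedProduct f.opposite),
      Module.Projective (CrossedProduct f.opposite) L)
    (I : Submodule (CrossedProduct f)ᵐᵒᵖ (CrossedProduct f)) :
    Module.Projective (CrossedProduct f)ᵐᵒᵖ I := by
  let e := oppositeEquiv f
  let L : Ideal (CrossedProduct f.opposite) :=
    { carrier := {a | (e a).unop ∈ I}
      add_mem' := fun ha hb ↦ by
        change (e (_ + _)).unop ∈ I
        rw [map_add, MulOpposite.unop_add]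
        exact add_mem ha hb
      zero_mem' := by
        change (e 0).unop ∈ I
        rw [map_zero]
        exact zero_mem I
      smul_mem' := fun c a ha ↦ by
        change (e (c * a)).unop ∈ I
        rw [map_mul, MulOpposite.unop_mul]
        exact I.smul_mem (e c) ha }
  have := h L
  have : RingHomInvPair (e : CrossedProduct f.opposite →+* (CrossedProduct f)ᵐᵒᵖ)
      (e.symm : (CrossedProduct f)ᵐᵒᵖ →+* CrossedProduct f.opposite) :=
    RingHomInvPair.of_ringEquiv e
  have : RingHomInvPair (e.symm : (CrossedProduct f)ᵐᵒᵖ →+* CrossedProduct f.opposite)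
      (e : CrossedProduct f.opposite →+* (CrossedProduct f)ᵐᵒᵖ) :=
    RingHomInvPair.of_ringEquiv e.symm
  let E : L ≃ₛₗ[(e : CrossedProduct f.opposite →+* (CrossedProduct f)ᵐᵒᵖ)] I :=
    { toFun := fun a ↦ ⟨(e a).unop, a.2⟩
      invFun := fun b ↦ ⟨e.symm (MulOpposite.op b), by
        change (e (e.symm _)).unop ∈ I
        rw [e.apply_symm_apply]
        exact b.2⟩
      left_inv := fun a ↦ Subtype.ext (e.symm_apply_apply a.1)
      right_inv := fun b ↦ Subtype.ext (by
        change (e (e.symm _)).unop = _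
        rw [e.apply_symm_apply]; rfl)
      map_add' := fun a b ↦ Subtype.ext (by
        change (e (a.1 + b.1)).unop = _
        rw [map_add]; rfl)
      map_smul' := fun c a ↦ Subtype.ext (by
        change (e (c * a.1)).unop = _
        rw [map_mul]; rfl) }
  exact Module.Projective.of_equiv E

end Opposite

end CrossedProduct

/-! ### Unramified extensions of discrete valuation rings -/

section Arithmetic

/-- In a Dedekind domain, let `ϖ ≠ 0` lie in every maximal ideal and generate a radical ideal. The
divisors of `ϖ` are the elements that lie in the square of no maximal ideal. -/
theorem IsDedekindDomain.dvd_iff_forall_notMem_sq {S : Type*} [CommRing S] [IsDedekindDomain S]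
    {ϖ : S} (hϖ : ϖ ≠ 0) (hmem : ∀ M : Ideal S, M.IsMaximal → ϖ ∈ M)
    (hrad : (Ideal.span {ϖ}).IsRadical) {s : S} :
    s ∣ ϖ ↔ ∀ M : Ideal S, M.IsMaximal → s ∉ M ^ 2 := by
  have hsq : Squarefree (Ideal.span {ϖ}) := by
    refine IsRadical.squarefree (by simpa using hϖ) fun n I h ↦ ?_
    rw [Ideal.dvd_iff_le] at h ⊢
    exact fun x hx ↦ hrad ⟨n, h (Ideal.pow_mem_pow hx n)⟩
  constructor
  · intro h M hM hs
    have h1 : M * M ∣ Ideal.span {ϖ} := by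
      rw [← pow_two]
      refine Ideal.dvd_iff_le.2 ((Ideal.span_singleton_le_span_singleton.2 h).trans ?_)
      rwa [Ideal.span_singleton_le_iff_mem]
    exact hM.ne_top (Ideal.isUnit_iff.1 (hsq M h1))
  · intro h
    have hs0 : s ≠ 0 := by
      rintro rfl
      obtain ⟨M, hM⟩ := Ideal.exists_maximal S
      exact h M hM (zero_mem _)
    have hsq' : Squarefree (Ideal.span {s}) := fun I hI ↦ by
      by_contra hu
      obtain ⟨M, hM, hIM⟩ := Ideal.exists_le_maximal I (mt Ideal.isUnit_iff.2 hu)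
      refine h M hM ?_
      rw [← Ideal.span_singleton_le_iff_mem, pow_two]
      exact (Ideal.dvd_iff_le.1 hI).trans (Ideal.mul_mono hIM hIM)
    have hmem' : ϖ ∈ (Ideal.span {s}).radical := by
      rw [Ideal.radical_eq_sInf, Submodule.mem_sInf]
      rintro p ⟨hle, hp⟩
      refine hmem p (hp.isMaximal ?_)
      rintro rfl
      exact hs0 (by simpa using hle)
    obtain ⟨n, hn⟩ := hmem'
    have h1 : Ideal.span {s} ∣ Ideal.span {ϖ} ^ n := by
      rwa [Ideal.span_singleton_pow, Ideal.dvd_span_singleton]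
    have h2 := hsq'.isRadical n _ h1
    rwa [Ideal.dvd_span_singleton, Ideal.mem_span_singleton] at h2

/-- An unramified algebra over a local ring is reduced modulo the maximal ideal. -/
theorem Algebra.FormallyUnramified.isRadical_map_maximalIdeal (V S : Type*) [CommRing V]
    [IsLocalRing V] [CommRing S] [Algebra V S] [Algebra.FormallyUnramified V S]
    [Algebra.EssFiniteType V S] :
    ((IsLocalRing.maximalIdeal V).map (algebraMap V S)).IsRadical := by
  let m := IsLocalRing.maximalIdeal V
  let _ : Field (V ⧸ m) := Ideal.Quotient.field m
  have : Algebra.FormallyUnramified V (S ⧸ m.map (algebraMap V S)) := inferInstance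
  have : Algebra.FormallyUnramified (V ⧸ m) (S ⧸ m.map (algebraMap V S)) :=
    .of_restrictScalars V _ _
  have : Algebra.EssFiniteType (V ⧸ m) (S ⧸ m.map (algebraMap V S)) := .of_comp V _ _
  have := Algebra.FormallyUnramified.isReduced_of_field (V ⧸ m) (S ⧸ m.map (algebraMap V S))
  exact Ideal.isRadical_iff_quotient_reduced _ |>.2 this

/-- Two endomorphisms of an unramified algebra that agree modulo a proper ideal are equal: they
agree modulo all its powers. -/
theorem Algebra.FormallyUnramified.exists_sub_notMem {V S : Type*} [CommRing V] [CommRing S]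
    [IsDomain S] [IsNoetherianRing S] [Algebra V S] [Algebra.FormallyUnramified V S]
    {φ ψ : S →ₐ[V] S} (h : φ ≠ ψ) {M : Ideal S} (hM : M ≠ ⊤) : ∃ s, φ s - ψ s ∉ M := by
  by_contra! hs
  exact h (Algebra.FormallyUnramified.ext_of_iInf M (Ideal.iInf_pow_eq_bot_of_isDomain M hM)
    fun x ↦ Ideal.Quotient.eq.2 (hs x))

/-- A finite algebra over a local ring, killed by the maximal ideal, is Artinian. -/
theorem IsArtinianRing.of_finite_of_maximalIdeal_smul_eq_zero (V B : Type*) [CommRing V]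
    [IsLocalRing V] [Ring B] [Algebra V B] [Module.Finite V B]
    (h : ∀ v ∈ IsLocalRing.maximalIdeal V, ∀ b : B, v • b = 0) : IsArtinianRing B := by
  let m := IsLocalRing.maximalIdeal V
  let _ : Field (V ⧸ m) := Ideal.Quotient.field m
  have ht : Module.IsTorsionBySet V B m := fun x a ↦ h a a.2 x
  let _ : Module (V ⧸ m) B := ht.module
  have : IsScalarTower V (V ⧸ m) B := ht.isScalarTower
  have : IsScalarTower (V ⧸ m) B B := ⟨fun v a b ↦ by
    obtain ⟨v, rfl⟩ := Ideal.Quotient.mk_surjective v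
    exact smul_mul_assoc v a b⟩
  have : Module.Finite (V ⧸ m) B := Module.Finite.of_restrictScalars_finite V _ _
  exact isArtinian_of_tower (V ⧸ m) inferInstance

end Arithmetic

/-! ### Hereditary crossed-product orders -/

namespace CrossedProduct

variable {V G S : Type*} [CommRing V] [IsDomain V] [IsDiscreteValuationRing V] [Group G] [Finite G]
  [CommRing S] [IsDomain S] [MulSemiringAction G S] [Algebra V S] [SMulCommClass G V S]
  [Module.Finite V S]

/-- The sufficiency of the condition, for left ideals. -/
theorem projective_leftIdeal {ϖ : V} (hirr : Irreducible ϖ)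
    (hϖ : algebraMap V S ϖ ≠ 0)
    (hrad : ∀ s : S, algebraMap V S ϖ ∣ s ↔ ∀ M : Ideal S, M.IsMaximal → s ∈ M)
    (hinert : ∀ (M : Ideal S), M.IsMaximal → ∀ σ : G, σ ≠ 1 → ∃ s : S, σ • s - s ∉ M)
    (f : NormalizedTwoCocycle G S) (hdvd : ∀ τ : G, f.val τ τ⁻¹ ∣ algebraMap V S ϖ)
    (hf : ∀ (τ : G) (M : Ideal S), M.IsMaximal → f.val τ τ⁻¹ ∉ M ^ 2)
    (L : Ideal (CrossedProduct f)) : Module.Projective (CrossedProduct f) L := by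
  have hfix : ∀ σ : G, σ • algebraMap V S ϖ = algebraMap V S ϖ := fun σ ↦ smul_algebraMap σ ϖ
  let J := traceRadical f hfix
  have hmem : ∀ a, ϖ • a ∈ J := fun a σ ↦ by
    rw [coeff_smul, mul_assoc]
    exact dvd_mul_right _ _
  have : Module.Finite V (CrossedProduct f ⧸ J) :=
    Module.Finite.of_surjective ((Submodule.mkQ J).restrictScalars V) (Submodule.mkQ_surjective J)
  have : IsArtinianRing (CrossedProduct f ⧸ J) := by
    refine .of_finite_of_maximalIdeal_smul_eq_zero V _ fun v hv b ↦ ?_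
    rw [hirr.maximalIdeal_eq, Ideal.mem_span_singleton] at hv
    obtain ⟨w, rfl⟩ := hv
    obtain ⟨a, rfl⟩ := Ideal.Quotient.mk_surjective b
    rw [mul_smul]
    exact Ideal.Quotient.eq_zero_iff_mem.2 (hmem (w • a))
  have : IsSemisimpleRing (CrossedProduct f ⧸ J) :=
    isSemisimpleRing_quotient_traceRadical hrad hinert
  have : Module.Projective (CrossedProduct f) J := projective_traceRadical hϖ hdvd hf
  refine Ideal.projective_of_isSemisimpleRing_quotient (V := V) (ϖ := ϖ) ?_ ?_ J (Nat.card G) ?_ L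
  · rw [hirr.maximalIdeal_eq]
    exact Ideal.mem_span_singleton_self ϖ
  · refine fun a ha ↦ ext_coeff fun σ ↦ ?_
    have := congrArg (coeff σ) ha
    rw [coeff_smul, map_zero] at this
    rw [(mul_eq_zero.1 this).resolve_left hϖ, map_zero]
  · intro a ha
    obtain ⟨b, hb⟩ := exists_coeff_eq_mul_of_forall_dvd
      (dvd_coeff_of_mem_traceRadical_pow hrad ha)
    exact ⟨b, ext_coeff fun σ ↦ by rw [hb, coeff_smul]⟩

end CrossedProduct

theorem mainTheorem1
    {V F K : Type*} [CommRing V] [IsDomain V] [IsDiscreteValuationRing V]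
    [Field F] [Algebra V F] [IsFractionRing V F]
    [Field K] [Algebra F K] [FiniteDimensional F K] [IsGalois F K]
    [Algebra V K] [IsScalarTower V F K]
    [Algebra.Unramified V (integralClosure V K)]
    (f : NormalizedTwoCocycle (K ≃ₐ[F] K) (integralClosure V K))
    (hf : ∀ σ τ : K ≃ₐ[F] K, f.val σ τ ≠ 0) :
    IsHereditaryRing (CrossedProduct f) ↔
      ∀ (τ : K ≃ₐ[F] K) (M : Ideal (integralClosure V K)),
        M.IsMaximal → f.val τ τ⁻¹ ∉ M ^ 2 := by
  let S := integralClosure V K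
  have : IsDedekindDomain S := integralClosure.isDedekindDomain V F K
  have : Module.Finite V S := IsIntegralClosure.finite V F K S
  have : FaithfulSMul V K := by
    rw [faithfulSMul_iff_algebraMap_injective, IsScalarTower.algebraMap_eq V F K]
    exact (algebraMap F K).injective.comp (IsFractionRing.injective V F)
  have hinj : Function.Injective (algebraMap V S) := FaithfulSMul.algebraMap_injective V S
  obtain ⟨p, hp⟩ := IsDiscreteValuationRing.exists_irreducible V
  set ϖ := algebraMap V S p with hϖdef
  have hϖ : ϖ ≠ 0 := (map_ne_zero_iff _ hinj).2 hp.ne_zero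
  have hmem : ∀ M : Ideal S, M.IsMaximal → ϖ ∈ M := fun M hM ↦ by
    have : (M.comap (algebraMap V S)).IsMaximal :=
      Ideal.isMaximal_comap_of_isIntegral_of_isMaximal M
    rw [hϖdef, ← Ideal.mem_comap, IsLocalRing.eq_maximalIdeal this, hp.maximalIdeal_eq]
    exact Ideal.mem_span_singleton_self p
  have hradical : (Ideal.span {ϖ}).IsRadical := by
    have := Algebra.FormallyUnramified.isRadical_map_maximalIdeal V S
    rwa [hp.maximalIdeal_eq, Ideal.map_span, Set.image_singleton] at this
  have hdvd_iff := fun s : S ↦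
    IsDedekindDomain.dvd_iff_forall_notMem_sq hϖ hmem hradical (s := s)
  have hrad : ∀ s : S, ϖ ∣ s ↔ ∀ M : Ideal S, M.IsMaximal → s ∈ M := fun s ↦ by
    refine ⟨fun h M hM ↦ M.mem_of_dvd h (hmem M hM), fun h ↦ ?_⟩
    rw [← Ideal.mem_span_singleton, ← hradical.radical, Ideal.radical_eq_sInf,
      Submodule.mem_sInf]
    rintro P ⟨hle, hP⟩
    refine h P (hP.isMaximal ?_)
    rintro rfl
    exact hϖ (by simpa using hle)
  have hfix : ∀ σ : K ≃ₐ[F] K, σ • ϖ = ϖ := fun σ ↦ smul_algebraMap σ p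
  have hinert : ∀ M : Ideal S, M.IsMaximal → ∀ σ : K ≃ₐ[F] K, σ ≠ 1 →
      ∃ s : S, σ • s - s ∉ M := fun M hM σ hσ ↦ by
    refine Algebra.FormallyUnramified.exists_sub_notMem
      (φ := MulSemiringAction.toAlgHom V S σ) (ψ := AlgHom.id V S) (fun h ↦ hσ ?_) hM.ne_top
    -- An automorphism that is trivial on `S` is trivial on its fraction field `K`.
    have := integralClosure.isFractionRing_of_finite_extension (A := V) F K
    refine AlgEquiv.ext fun x ↦ ?_
    obtain ⟨a, b, -, rfl⟩ := IsFractionRing.div_surjective (A := S) x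
    have h1 : ∀ s : S, σ (algebraMap S K s) = algebraMap S K s := fun s ↦
      congrArg (algebraMap S K) (AlgHom.congr_fun h s)
    rw [map_div₀, h1, h1, AlgEquiv.one_apply]
  constructor
  · intro h τ
    exact (hdvd_iff _).1 (CrossedProduct.val_mul_inv_dvd_of_projective hfix hmem h.1 τ)
  · intro h
    have hleft : ∀ g : NormalizedTwoCocycle (K ≃ₐ[F] K) S, (∀ τ, g.val τ τ⁻¹ = f.val τ τ⁻¹) →
        ∀ L : Ideal (CrossedProduct g), Module.Projective (CrossedProduct g) L := fun g hg ↦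
      CrossedProduct.projective_leftIdeal hp hϖ hrad hinert g
        (fun τ ↦ by rw [hg]; exact (hdvd_iff _).2 (h τ)) (fun τ ↦ by rw [hg]; exact h τ)
    exact ⟨hleft f fun _ ↦ rfl,
      CrossedProduct.projective_rightIdeal f (hleft f.opposite f.opposite_val_inv)⟩
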